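/- Let $R$ be an associative unital ring (not necessarily commutative); "module" means right $R$-module. For a class $\mathcal Q$ of left $R$-modules, a module $M$ is called $\mathcal Q$-Mittag-Leffler if the canonical group homomorphism $$M\otimes_R\prod_{i\in I}Q_i\longrightarrow\prod_{i\in I}M\otimes_R Q_i,\qquad m\otimes(q_i)_{i\in I}\mapsto(m\otimes q_i)_{i\in I},$$ is injective for every family $(Q_i\mid i\in I)$ of elements of $\mathcal Q$; it is called Mittag-Leffler if this map is injective for every family of left $R$-modules. Let $\mathcal F$ be the class of all flat modules, $\mathcal{FM}$ the class of all flat Mittag-Leffler modules, and $\mathcal D_{\mathcal Q}$ the class of all flat $\mathcal Q$-Mittag-Leffler modules. A module is countably presented if it is isomorphic to the quotient of a free module of countable rank by a countably generated submodule. Then: (i) Let $\mathcal Q$ and $\mathcal Q'$ be classes of left $R$-modules, both containing the left module $R$. Then $\mathcal D_{\mathcal Q}=\mathcal D_{\mathcal Q'}$ if and only if $\mathcal D_{\mathcal Q}$ and $\mathcal D_{\mathcal Q'}$ contain the same countably presented modules. (ii) Let $\mathcal Q$ be an arbitrary class of left $R$-modules. Then $\mathcal D_{\mathcal Q}=\mathcal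 F$ if and only if every countably presented flat module is $\mathcal Q$-Mittag-Leffler. (iii) Let $\mathcal Q$ be a class of left $R$-modules containing $R$. Then $\mathcal D_{\mathcal Q}=\mathcal{FM}$ if and only if every countably presented flat $\mathcal Q$-Mittag-Leffler module is projective. -/

import Mathlib

open scoped TensorProduct

universe u

namespace RelML

section Tensor

variable {R : Type*} [Ring R]

/-- The relations `(m r) ⊗ n = m ⊗ (r n)`, as a subgroup of `M ⊗_ℤ N`. Right `R`-modules are
modules over `Rᵐᵒᵖ`. -/
def balanced (R : Type*) [Ring R] (M : Type*) [AddCommGroup M] [Module Rᵐᵒᵖ M]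
    (N : Type*) [AddCommGroup N] [Module R N] : AddSubgroup (M ⊗[ℤ] N) :=
  AddSubgroup.closure {x | ∃ (m : M) (r : R) (n : N),
    x = (MulOpposite.op r • m) ⊗ₜ[ℤ] n - m ⊗ₜ[ℤ] (r • n)}

/-- The tensor product `M ⊗_R N` of a right module `M` and a left module `N` over a (not
necessarily commutative) ring `R`; it is an abelian group. -/
abbrev Tensor (R : Type*) [Ring R] (M : Type*) [AddCommGroup M] [Module Rᵐᵒᵖ M]
    (N : Type*) [AddCommGroup N] [Module R N] : Type _ :=
  (M ⊗[ℤ] N) ⧸ balanced R M N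

/-- The elementary tensor `m ⊗ n` in `M ⊗_R N`. -/
def tmul (R : Type*) [Ring R] {M : Type*} [AddCommGroup M] [Module Rᵐᵒᵖ M]
    {N : Type*} [AddCommGroup N] [Module R N] (m : M) (n : N) : Tensor R M N :=
  QuotientAddGroup.mk' (balanced R M N) (m ⊗ₜ[ℤ] n)

variable (M : Type*) [AddCommGroup M] [Module Rᵐᵒᵖ M]
variable {N : Type*} [AddCommGroup N] [Module R N] {N' : Type*} [AddCommGroup N'] [Module R N']

/-- The group homomorphism `M ⊗_R f : M ⊗_R N → M ⊗_R N'` induced by an `R`-linear map `f`. -/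
def lTensor (f : N →ₗ[R] N') : Tensor R M N →+ Tensor R M N' :=
  QuotientAddGroup.map (balanced R M N) (balanced R M N')
    (LinearMap.lTensor M f.toAddMonoidHom.toIntLinearMap).toAddMonoidHom <| by
      refine (AddSubgroup.closure_le _).2 ?_
      rintro _ ⟨m, r, n, rfl⟩
      refine AddSubgroup.subset_closure ⟨m, r, f n, ?_⟩
      simp

theorem lTensor_tmul (f : N →ₗ[R] N') (m : M) (n : N) :
    lTensor M f (tmul R m n) = tmul R m (f n) := rfl

/-- The canonical map `M ⊗_R ∏ i, N i → ∏ i, M ⊗_R N i`. -/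
def piMap {I : Type*} (N : I → Type*) [∀ i, AddCommGroup (N i)] [∀ i, Module R (N i)] :
    Tensor R M (∀ i, N i) →+ ∀ i, Tensor R M (N i) :=
  AddMonoidHom.pi fun i => lTensor M (LinearMap.proj i : (∀ i, N i) →ₗ[R] N i)

theorem piMap_tmul {I : Type*} (N : I → Type*) [∀ i, AddCommGroup (N i)]
    [∀ i, Module R (N i)] (m : M) (n : ∀ i, N i) :
    piMap M N (tmul R m n) = fun i => tmul R m (n i) := rfl

end Tensor

variable {R : Type u} [Ring R]

/-- A right module `M` is flat if `M ⊗_R -` preserves injectivity of maps of left modules. -/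
def IsFlat (M : ModuleCat.{u} Rᵐᵒᵖ) : Prop :=
  ∀ (A B : ModuleCat.{u} R) (f : A →ₗ[R] B),
    Function.Injective f → Function.Injective (lTensor M f)

/-- `Q`-Mittag-Leffler right modules, for a class `Q` of left modules. -/
def IsRelMittagLeffler (Q : Set (ModuleCat.{u} R)) (M : ModuleCat.{u} Rᵐᵒᵖ) : Prop :=
  ∀ (I : Type u) (N : I → ModuleCat.{u} R), (∀ i, N i ∈ Q) →
    Function.Injective (piMap (R := R) M (fun i => N i))

/-- (Absolute) Mittag-Leffler right modules. -/
def IsMittagLeffler (M : ModuleCat.{u} Rᵐᵒᵖ) : Prop :=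
  ∀ (I : Type u) (N : I → ModuleCat.{u} R),
    Function.Injective (piMap (R := R) M (fun i => N i))

/-- `M` is the quotient of a free module of countable rank by a countably generated submodule. -/
def IsCountablyPresented (M : ModuleCat.{u} Rᵐᵒᵖ) : Prop :=
  ∃ f : (ℕ →₀ Rᵐᵒᵖ) →ₗ[Rᵐᵒᵖ] M, Function.Surjective f ∧
    ∃ t : Set (ℕ →₀ Rᵐᵒᵖ), t.Countable ∧ Submodule.span Rᵐᵒᵖ t = LinearMap.ker f

/-- The class `F` of all flat right modules. -/
def flatClass (R : Type u) [Ring R] : Set (ModuleCat.{u} Rᵐᵒᵖ) := {M | IsFlat M}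

/-- The class `FM` of all flat Mittag-Leffler right modules. -/
def flatMLClass (R : Type u) [Ring R] : Set (ModuleCat.{u} Rᵐᵒᵖ) :=
  {M | IsFlat M ∧ IsMittagLeffler M}

/-- The class `D_Q` of all flat `Q`-Mittag-Leffler right modules. -/
def flatRelMLClass (Q : Set (ModuleCat.{u} R)) : Set (ModuleCat.{u} Rᵐᵒᵖ) :=
  {M | IsFlat M ∧ IsRelMittagLeffler Q M}

end RelML

/-! Write a tensor as a row `m` over `M` paired with a column `q`. For flat `M`, `m q = 0` holds
exactly when `m = y A` for some row `y` and matrix `A` with `A q = 0` (`IsFlat.exists_factor`).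
Applied to one large product, this shows that flat `M` is `Q`-Mittag-Leffler iff every row has a
factorization `m = y A` whose `A` kills all columns over `Q` killed by `m` (`exists_dominates`,
`isRelMittagLeffler_of_exists_dominates`).

Everything rests on a transfer principle, `isRelMittagLeffler_of_forall_isCountablyPresented`.
Suppose `M` is flat and `Q`-Mittag-Leffler, but no factorization of some row `m` dominates for `Q'`.
Then factorizations of `m` can be chained so that each transition matrix dominates for `Q` and also
kills a column over `Q'` that was still alive. The colimit of the resulting sequence of free modules
is countably presented, flat and `Q`-Mittag-Leffler. It is not `Q'`-Mittag-Leffler: the chosen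
columns die one by one, but at no common stage.

Part (i) is this principle in both directions, and (ii) is the case of the empty class as source.
Part (iii) takes all left modules as target, using that projectives are Mittag-Leffler and that
countably presented flat Mittag-Leffler modules are projective
(`projective_of_isCountablyPresented`). -/

namespace RelML

open MulOpposite

/-! ### Tensor products over a noncommutative ring -/

section TensorLemmas

variable {R : Type*} [Ring R]
variable {M : Type*} [AddCommGroup M] [Module Rᵐᵒᵖ M] {M' : Type*} [AddCommGroup M'] [Module Rᵐᵒᵖ M']
variable {N : Type*} [AddCommGroup N] [Module R N] {N' : Type*} [AddCommGroup N'] [Module R N']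
variable {G : Type*} [AddCommGroup G]

theorem op_smul_tmul (r : R) (m : M) (n : N) : tmul R (op r • m) n = tmul R m (r • n) :=
  QuotientAddGroup.eq_iff_sub_mem.2 (AddSubgroup.subset_closure ⟨m, r, n, rfl⟩)

/-- The elementary tensor as a biadditive map. -/
def tmulHom (R : Type*) [Ring R] (M : Type*) [AddCommGroup M] [Module Rᵐᵒᵖ M]
    (N : Type*) [AddCommGroup N] [Module R N] : M →+ N →+ Tensor R M N :=
  AddMonoidHom.mk' (fun m => AddMonoidHom.mk' (fun n => tmul R m n) fun a b => by
    simp [tmul, TensorProduct.tmul_add]) fun a b => by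
    ext n
    simp [tmul, TensorProduct.add_tmul]

theorem tmulHom_apply (m : M) (n : N) : tmulHom R M N m n = tmul R m n := rfl

@[simp] theorem tmul_zero (m : M) : tmul R m (0 : N) = 0 := map_zero (tmulHom R M N m)

theorem tmul_sum {ι : Type*} (s : Finset ι) (m : M) (n : ι → N) :
    tmul R m (∑ i ∈ s, n i) = ∑ i ∈ s, tmul R m (n i) := map_sum (tmulHom R M N m) n s

theorem sum_tmul {ι : Type*} (s : Finset ι) (m : ι → M) (n : N) :
    tmul R (∑ i ∈ s, m i) n = ∑ i ∈ s, tmul R (m i) n := by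
  simp only [← tmulHom_apply, map_sum, AddMonoidHom.finsetSum_apply]

theorem Tensor.induction {p : Tensor R M N → Prop} (zero : p 0) (tmul : ∀ m n, p (tmul R m n))
    (add : ∀ x y, p x → p y → p (x + y)) (x : Tensor R M N) : p x := by
  obtain ⟨x, rfl⟩ := QuotientAddGroup.mk'_surjective _ x
  induction x using TensorProduct.induction_on with
  | zero => simpa using zero
  | tmul m n => exact tmul m n
  | add x y hx hy => rw [map_add]; exact add _ _ hx hy

/-- The homomorphism out of `M ⊗_R N` induced by a balanced biadditive map. -/
def Tensor.lift (f : M →+ N →+ G) (hf : ∀ m (r : R) n, f (op r • m) n = f m (r • n)) :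
    Tensor R M N →+ G :=
  QuotientAddGroup.lift (balanced R M N)
    (TensorProduct.liftAddHom f fun r m n => by simp) <| by
      refine (AddSubgroup.closure_le _).2 ?_
      rintro _ ⟨m, r, n, rfl⟩
      simp [hf]

@[simp] theorem Tensor.lift_tmul (f : M →+ N →+ G)
    (hf : ∀ m (r : R) n, f (op r • m) n = f m (r • n)) (m : M) (n : N) :
    Tensor.lift f hf (tmul R m n) = f m n := rfl

/-- The homomorphism `φ ⊗_R N` induced by a map `φ` of right modules. -/
def rTensor (N : Type*) [AddCommGroup N] [Module R N] (φ : M →ₗ[Rᵐᵒᵖ] M') :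
    Tensor R M N →+ Tensor R M' N :=
  Tensor.lift ((tmulHom R M' N).comp φ.toAddMonoidHom) fun m r n => by
    simp [tmulHom_apply, op_smul_tmul]

theorem rTensor_tmul (φ : M →ₗ[Rᵐᵒᵖ] M') (m : M) (n : N) :
    rTensor N φ (tmul R m n) = tmul R (φ m) n := rfl

end TensorLemmas

/-! ### Calculus of rows, columns and matrices -/

section Tuples

variable {R : Type*} [Ring R]
variable {M : Type*} [AddCommGroup M] [Module Rᵐᵒᵖ M] {M' : Type*} [AddCommGroup M'] [Module Rᵐᵒᵖ M']
variable {N : Type*} [AddCommGroup N] [Module R N] {N' : Type*} [AddCommGroup N'] [Module R N']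
variable {ι κ μ : Type*}

/-- The tensor `∑ i, y i ⊗ q i`. -/
def pair [Fintype ι] (y : ι → M) (q : ι → N) : Tensor R M N := ∑ i, tmul R (y i) (q i)

/-- The product of a matrix and a column of elements of a left module. -/
def act [Fintype ι] (A : Matrix κ ι R) (q : ι → N) : κ → N := fun j => ∑ i, A j i • q i

/-- The right linear combination `∑ i, y i * r i`. -/
def rdot [Fintype ι] (y : ι → M) (r : ι → R) : M := ∑ i, op (r i) • y i

/-- The product of a row of elements of a right module and a matrix. -/
def ract [Fintype κ] (y : κ → M) (A : Matrix κ ι R) : ι → M := fun i => rdot y fun j => A j i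

@[simp] theorem act_zero [Fintype ι] (A : Matrix κ ι R) : act A (0 : ι → N) = 0 := by
  ext; simp [act]

theorem act_mul [Fintype ι] [Fintype κ] (B : Matrix μ κ R) (A : Matrix κ ι R) (q : ι → N) :
    act (B * A) q = act B (act A q) := by
  ext l
  simp only [act, Matrix.mul_apply, Finset.sum_smul, Finset.smul_sum, mul_smul]
  exact Finset.sum_comm

@[simp] theorem act_one [Fintype ι] [DecidableEq ι] (q : ι → N) : act (1 : Matrix ι ι R) q = q := by
  ext l
  simp [act, Matrix.one_apply]

theorem map_act [Fintype ι] (f : N →ₗ[R] N') (A : Matrix κ ι R) (q : ι → N) :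
    (fun j => f (act A q j)) = act A fun i => f (q i) := by
  ext; simp [act]

@[simp] theorem rdot_zero [Fintype ι] (y : ι → M) : rdot y (0 : ι → R) = 0 := by simp [rdot]

theorem rdot_add [Fintype ι] (y : ι → M) (r r' : ι → R) : rdot y (r + r') = rdot y r + rdot y r' := by
  simp [rdot, add_smul, Finset.sum_add_distrib]

theorem add_rdot [Fintype ι] (y y' : ι → M) (r : ι → R) : rdot (y + y') r = rdot y r + rdot y' r := by
  simp [rdot, Finset.sum_add_distrib]

theorem rdot_ract [Fintype ι] [Fintype κ] (y : κ → M) (A : Matrix κ ι R) (r : ι → R) :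
    rdot (ract y A) r = rdot y (act A r) := by
  simp only [rdot, ract, act, Finset.smul_sum, smul_eq_mul, Finset.op_sum, op_mul, Finset.sum_smul,
    mul_smul]
  exact Finset.sum_comm

theorem ract_mul [Fintype κ] [Fintype μ] (y : μ → M) (B : Matrix μ κ R) (A : Matrix κ ι R) :
    ract y (B * A) = ract (ract y B) A := by
  ext i
  simp only [ract]
  rw [← ract, rdot_ract]
  rfl

@[simp] theorem ract_one [Fintype ι] [DecidableEq ι] (y : ι → M) : ract y (1 : Matrix ι ι R) = y := by
  ext l
  simp [ract, rdot, Matrix.one_apply, apply_ite op, ite_smul]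

theorem add_ract [Fintype κ] (y y' : κ → M) (A : Matrix κ ι R) : ract (y + y') A = ract y A + ract y' A := by
  ext; simp [ract, add_rdot]

theorem map_rdot [Fintype ι] (f : M →ₗ[Rᵐᵒᵖ] M') (y : ι → M) (r : ι → R) :
    f (rdot y r) = rdot (fun i => f (y i)) r := by
  simp [rdot]

theorem map_ract [Fintype κ] (f : M →ₗ[Rᵐᵒᵖ] M') (y : κ → M) (A : Matrix κ ι R) :
    (fun i => f (ract y A i)) = ract (fun j => f (y j)) A := by
  ext; simp [ract, map_rdot]

@[simp] theorem pair_zero [Fintype ι] (y : ι → M) : pair (R := R) y (0 : ι → N) = 0 := by simp [pair]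

theorem pair_add [Fintype ι] (y : ι → M) (q q' : ι → N) :
    pair (R := R) y (q + q') = pair y q + pair y q' := by
  simp [pair, ← tmulHom_apply, Finset.sum_add_distrib]

theorem pair_ract [Fintype ι] [Fintype κ] (y : κ → M) (A : Matrix κ ι R) (q : ι → N) :
    pair (R := R) (ract y A) q = pair y (act A q) := by
  simp only [pair, ract, rdot, act, sum_tmul, tmul_sum, op_smul_tmul]
  exact Finset.sum_comm

theorem tmul_rdot [Fintype ι] (y : ι → M) (r : ι → R) (n : N) :
    tmul R (rdot y r) n = pair y fun i => r i • n := by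
  simp only [pair, rdot, sum_tmul, op_smul_tmul]

theorem pair_eq_tmul_rdot [Fintype ι] (y : ι → M) (r : ι → R) :
    pair (R := R) y r = tmul R (rdot y r) (1 : R) := by
  simp [tmul_rdot]

theorem lTensor_pair [Fintype ι] (f : N →ₗ[R] N') (y : ι → M) (q : ι → N) :
    lTensor M f (pair y q) = pair y fun i => f (q i) := by
  simp [pair, map_sum, lTensor_tmul]

theorem piMap_pair [Fintype ι] {I : Type*} (P : I → Type*) [∀ i, AddCommGroup (P i)] [∀ i, Module R (P i)]
    (y : ι → M) (q : ι → ∀ i, P i) (i : I) :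
    piMap M P (pair (R := R) y q) i = pair y fun j => q j i := by
  simp only [pair, map_sum, piMap_tmul, Finset.sum_apply]

theorem rTensor_pair [Fintype ι] (φ : M →ₗ[Rᵐᵒᵖ] M') (y : ι → M) (q : ι → N) :
    rTensor N φ (pair (R := R) y q) = pair (fun i => φ (y i)) q := by
  simp [pair, map_sum, rTensor_tmul]

theorem act_apply_pi [Fintype ι] {I : Type*} (P : I → Type*) [∀ i, AddCommGroup (P i)] [∀ i, Module R (P i)]
    (A : Matrix κ ι R) (q : ι → ∀ i, P i) (j : κ) (i : I) :
    act A q j i = act A (fun l => q l i) j := by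
  simp [act]

end Tuples

/-! ### Flatness and domination by factorizations -/

section Flat

variable {R : Type u} [Ring R]

/-- Right exactness made explicit: `M ⊗ (R^n / K)` maps to `M^n` modulo the image of `M ⊗ K`, and
the given tensor goes to the class of `m`. -/
theorem exists_eq_ract_of_pair_mkQ_eq_zero {M : Type*} [AddCommGroup M] [Module Rᵐᵒᵖ M] {n : ℕ}
    (m : Fin n → M) (K : Submodule R (Fin n → R))
    (h : pair (R := R) m (fun i => K.mkQ (Pi.single i 1)) = 0) :
    ∃ (k : ℕ) (y : Fin k → M) (A : Matrix (Fin k) (Fin n) R), m = ract y A ∧ ∀ j, A j ∈ K := by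
  let scale : (Fin n → R) →+ M →+ (Fin n → M) :=
    AddMonoidHom.mk' (fun r => AddMonoidHom.mk' (fun x i => op (r i) • x) fun a b => by
      ext; simp) fun r s => by
      ext; simp [add_smul]
  have scale_apply (r : Fin n → R) (x : M) : scale r x = fun i => op (r i) • x := rfl
  let F : (K →₀ M) →+ (Fin n → M) := Finsupp.liftAddHom fun r : K => scale r
  let β : (Fin n → R) ⧸ K →+ M →+ (Fin n → M) ⧸ F.range :=
    QuotientAddGroup.lift K.toAddSubgroup
      ((AddMonoidHom.compHom (QuotientAddGroup.mk' F.range)).comp scale) fun r hr => by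
        ext x
        refine (QuotientAddGroup.eq_zero_iff _).2 ⟨Finsupp.single ⟨r, hr⟩ x, ?_⟩
        simp [F]
  have hβ : ∀ (x : M) (s : R) (r : (Fin n → R) ⧸ K), β.flip (op s • x) r = β.flip x (s • r) := by
    intro x s r
    obtain ⟨r, rfl⟩ := K.mkQ_surjective r
    change QuotientAddGroup.mk' F.range (scale r (op s • x)) =
      QuotientAddGroup.mk' F.range (scale (s • r) x)
    simp [scale_apply, mul_smul]
  have hm : m ∈ F.range := by
    have h0 := congrArg (Tensor.lift β.flip hβ) h
    rw [map_zero, pair, map_sum] at h0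
    rw [← QuotientAddGroup.eq_zero_iff, ← h0]
    have h1 : ∀ i, Tensor.lift β.flip hβ (tmul R (m i) (K.mkQ (Pi.single i 1))) =
        QuotientAddGroup.mk' F.range (scale (Pi.single i 1) (m i)) := fun i => rfl
    simp only [h1, ← map_sum]
    refine congrArg (QuotientAddGroup.mk' F.range) ?_
    ext j
    simp [scale_apply, Finset.sum_apply, Pi.single_apply, apply_ite op, ite_smul]
  obtain ⟨f, hf⟩ := hm
  let e := f.support.equivFin
  refine ⟨_, fun j => f (e.symm j), fun j => ((e.symm j : K) : Fin n → R), ?_,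
    fun j => (e.symm j : K).2⟩
  rw [← hf]
  ext i
  simp only [F, Finsupp.liftAddHom_apply, Finsupp.sum, Finset.sum_apply, ract, rdot]
  rw [e.symm.sum_comp (fun b : f.support => op (((b : K) : Fin n → R) i) • f b)]
  exact (Finset.sum_coe_sort f.support
    (fun b : K => op ((b : Fin n → R) i) • f b)).symm

variable {M : ModuleCat.{u} Rᵐᵒᵖ}

/-- With `K` the relations among the entries of `q`, `R^n / K` embeds in `P`; flatness pulls the
vanishing back along this embedding. -/
theorem IsFlat.exists_factor (hM : IsFlat M) {n : ℕ} (m : Fin n → M) {P : Type u} [AddCommGroup P]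
    [Module R P] (q : Fin n → P) (h : pair (R := R) m q = 0) :
    ∃ (k : ℕ) (y : Fin k → M) (A : Matrix (Fin k) (Fin n) R), m = ract y A ∧ act A q = 0 := by
  let g : (Fin n → R) →ₗ[R] P := Fintype.linearCombination R q
  let f : ((Fin n → R) ⧸ LinearMap.ker g) →ₗ[R] P := (LinearMap.ker g).liftQ g le_rfl
  have hf : Function.Injective f := LinearMap.ker_eq_bot.1 (Submodule.ker_liftQ_eq_bot' _ _ rfl)
  obtain ⟨k, y, A, hm, hA⟩ := exists_eq_ract_of_pair_mkQ_eq_zero m (LinearMap.ker g) <| by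
    refine hM (ModuleCat.of R _) (ModuleCat.of R P) f hf ?_
    rw [map_zero, lTensor_pair, ← h]
    congr 1
    ext i
    simp [f, g, Fintype.linearCombination_apply_single]
  refine ⟨k, y, A, hm, ?_⟩
  ext j
  simpa [g, Fintype.linearCombination_apply, act] using hA j

/-- The matrix `A` kills every column `q` over a member of `Q` that `m` kills. -/
def Dominates (Q : Set (ModuleCat.{u} R)) {M : Type*} [AddCommGroup M] [Module Rᵐᵒᵖ M]
    {ι κ : Type*} [Fintype ι] (m : ι → M) (A : Matrix κ ι R) : Prop :=
  ∀ P ∈ Q, ∀ q : ι → P, pair (R := R) m q = 0 → act A q = 0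

theorem exists_dominates {Q : Set (ModuleCat.{u} R)} (hM : IsFlat M) (hQ : IsRelMittagLeffler Q M)
    {n : ℕ} (m : Fin n → M) :
    ∃ (k : ℕ) (y : Fin k → M) (A : Matrix (Fin k) (Fin n) R), m = ract y A ∧ Dominates Q m A := by
  -- Columns over `Q` need not form a small set. Whether a matrix kills `q` depends only on the
  -- relation module of `q`, so one column per submodule of `R^n` suffices.
  let I : Type u := {K : Submodule R (Fin n → R) // ∃ P ∈ Q, ∃ q : Fin n → P,
    pair (R := R) m q = 0 ∧ K = LinearMap.ker (Fintype.linearCombination R q)}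
  choose P hP q hq hK using fun i : I => i.2
  have h0 : pair (R := R) m (fun j i => q i j : Fin n → ∀ i, P i) = 0 := by
    refine hQ I P hP ?_
    ext i
    rw [piMap_pair, hq, map_zero, Pi.zero_apply]
  obtain ⟨k, y, A, hm, hA⟩ := hM.exists_factor m _ h0
  refine ⟨k, y, A, hm, fun P' hP' q' hq' => ?_⟩
  let i : I := ⟨LinearMap.ker (Fintype.linearCombination R q'), P', hP', q', hq', rfl⟩
  ext j
  have h1 : A j ∈ LinearMap.ker (Fintype.linearCombination R (q i)) := by
    have := congrFun (congrFun hA j) i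
    rw [act_apply_pi] at this
    simpa [Fintype.linearCombination_apply, act] using this
  rw [← hK i] at h1
  simpa [i, Fintype.linearCombination_apply, act] using h1

end Flat

/-! ### Sequential colimits of finite free modules -/

section Colimit

variable {R : Type u} [Ring R] {d : ℕ → ℕ} (A : ∀ k, Matrix (Fin (d (k + 1))) (Fin (d k)) R)

/-- The composite transition matrix from level `k` to level `l`; it is zero unless `k ≤ l`. -/
def trans (k l : ℕ) : Matrix (Fin (d l)) (Fin (d k)) R :=
  if h : k ≤ l then
    Nat.leRec (motive := fun m _ => Matrix (Fin (d m)) (Fin (d k)) R) 1 (fun m _ B => A m * B) h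
  else 0

@[simp] theorem trans_self (k : ℕ) : trans A k k = 1 := by simp [trans]

theorem trans_succ {k l : ℕ} (h : k ≤ l) : trans A k (l + 1) = A l * trans A k l := by
  rw [trans, dif_pos (Nat.le_succ_of_le h), Nat.leRec_succ _ _ h, trans, dif_pos h]

theorem trans_succ_mul {k l : ℕ} (h : k + 1 ≤ l) : trans A (k + 1) l * A k = trans A k l := by
  induction l, h using Nat.le_induction with
  | base => simp [trans_succ]
  | succ l hl ih => rw [trans_succ A hl, trans_succ A (Nat.le_of_succ_le hl), Matrix.mul_assoc, ih]

theorem eq_ract_trans {M : Type*} [AddCommGroup M] [Module Rᵐᵒᵖ M] {y : ∀ k, Fin (d k) → M}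
    (hy : ∀ k, y k = ract (y (k + 1)) (A k)) {k l : ℕ} (h : k ≤ l) :
    y k = ract (y l) (trans A k l) := by
  induction l, h using Nat.le_induction with
  | base => simp
  | succ l hl ih => rw [trans_succ A hl, ract_mul, ← hy, ← ih]

/-- The relation identifying a basis element of one level with its image in the next level. -/
noncomputable def levelRel (p : Σ k, Fin (d k)) : (Σ k, Fin (d k)) →₀ Rᵐᵒᵖ :=
  Finsupp.single p 1 - rdot (fun j => Finsupp.single ⟨p.1 + 1, j⟩ 1) fun j => A p.1 j p.2

/-- The colimit of the free right modules `R ^ d k` along the maps given by the matrices `A k`. -/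
abbrev Colim : Type u :=
  ((Σ k, Fin (d k)) →₀ Rᵐᵒᵖ) ⧸ Submodule.span Rᵐᵒᵖ (Set.range (levelRel A))

/-- The images in the colimit of the basis elements of level `k`. -/
noncomputable def basisAt (k : ℕ) (i : Fin (d k)) : Colim A :=
  Submodule.mkQ _ (Finsupp.single ⟨k, i⟩ 1)

theorem basisAt_eq (k : ℕ) : basisAt A k = ract (basisAt A (k + 1)) (A k) := by
  ext i
  have h : Submodule.mkQ (Submodule.span Rᵐᵒᵖ (Set.range (levelRel A))) (levelRel A ⟨k, i⟩) = 0 := by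
    rw [Submodule.mkQ_apply, Submodule.Quotient.mk_eq_zero]
    exact Submodule.subset_span ⟨_, rfl⟩
  rw [levelRel, map_sub, map_rdot, sub_eq_zero] at h
  exact h

variable {A} in
/-- The map out of the colimit induced by a compatible sequence of rows. -/
noncomputable def Colim.desc {M : Type*} [AddCommGroup M] [Module Rᵐᵒᵖ M] (y : ∀ k, Fin (d k) → M)
    (hy : ∀ k, y k = ract (y (k + 1)) (A k)) : Colim A →ₗ[Rᵐᵒᵖ] M :=
  Submodule.liftQ _ (Finsupp.linearCombination Rᵐᵒᵖ fun p : Σ k, Fin (d k) => y p.1 p.2) <| by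
    rw [Submodule.span_le]
    rintro _ ⟨⟨k, i⟩, rfl⟩
    have := congrFun (hy k) i
    simpa [levelRel, map_rdot, sub_eq_zero, ract] using this

@[simp] theorem Colim.desc_basisAt {M : Type*} [AddCommGroup M] [Module Rᵐᵒᵖ M]
    (y : ∀ k, Fin (d k) → M) (hy : ∀ k, y k = ract (y (k + 1)) (A k)) (k : ℕ) (i : Fin (d k)) :
    Colim.desc y hy (basisAt A k i) = y k i := by
  simp [Colim.desc, basisAt]

theorem Colim.exists_rdot (x : Colim A) :
    ∃ K, ∀ k, K ≤ k → ∃ r : Fin (d k) → R, x = rdot (basisAt A k) r := by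
  obtain ⟨v, rfl⟩ := Submodule.mkQ_surjective _ x
  induction v using Finsupp.induction_linear with
  | zero => exact ⟨0, fun k _ => ⟨0, by simp⟩⟩
  | add v w hv hw =>
    obtain ⟨K, hK⟩ := hv
    obtain ⟨L, hL⟩ := hw
    refine ⟨max K L, fun k hk => ?_⟩
    obtain ⟨r, hr⟩ := hK k (le_of_max_le_left hk)
    obtain ⟨s, hs⟩ := hL k (le_of_max_le_right hk)
    exact ⟨r + s, by rw [map_add, hr, hs, rdot_add]⟩
  | single p a =>
    refine ⟨p.1, fun k hk => ⟨act (trans A p.1 k) (Pi.single p.2 (unop a)), ?_⟩⟩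
    rw [← rdot_ract, ← eq_ract_trans A (basisAt_eq A) hk]
    have : Finsupp.single p a = a • Finsupp.single p (1 : Rᵐᵒᵖ) := by simp
    rw [this, map_smul, rdot, Finset.sum_eq_single p.2]
    · simp [basisAt]
    · intro i _ hi
      simp [hi]
    · simp

/-- The component at level `l` of an element of the free module on all levels. -/
noncomputable def toLevel (l : ℕ) : ((Σ k, Fin (d k)) →₀ Rᵐᵒᵖ) →ₗ[Rᵐᵒᵖ] (Fin (d l) → R) :=
  Finsupp.linearCombination Rᵐᵒᵖ fun p j => trans A p.1 l j p.2

theorem toLevel_single (l k : ℕ) (i : Fin (d k)) :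
    toLevel A l (Finsupp.single ⟨k, i⟩ 1) = fun j => trans A k l j i := by
  simp [toLevel]

theorem eventually_toLevel_eq_zero {v : (Σ k, Fin (d k)) →₀ Rᵐᵒᵖ}
    (hv : v ∈ Submodule.span Rᵐᵒᵖ (Set.range (levelRel A))) :
    ∃ L, ∀ l, L ≤ l → toLevel A l v = 0 := by
  induction hv using Submodule.span_induction with
  | mem v hv =>
    obtain ⟨⟨k, i⟩, rfl⟩ := hv
    -- Level `k` is too early: there `trans A (k + 1) k` has its default value zero and nothing
    -- cancels.
    refine ⟨k + 1, fun l hl => ?_⟩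
    rw [levelRel, map_sub, map_rdot, toLevel_single, sub_eq_zero]
    ext j
    simp only [toLevel_single, rdot, ← trans_succ_mul A hl, Matrix.mul_apply, Finset.sum_apply,
      Pi.smul_apply, op_smul_eq_mul]
  | zero => exact ⟨0, fun _ _ => map_zero _⟩
  | add v w _ _ hv hw =>
    obtain ⟨K, hK⟩ := hv
    obtain ⟨L, hL⟩ := hw
    refine ⟨max K L, fun l hl => ?_⟩
    rw [map_add, hK l (le_of_max_le_left hl), hL l (le_of_max_le_right hl), add_zero]
  | smul a v _ hv =>
    obtain ⟨L, hL⟩ := hv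
    exact ⟨L, fun l hl => by rw [map_smul, hL l hl, smul_zero]⟩

/-- Tensoring commutes with the colimit. Levelwise components map the tensor product to families
modulo the eventually zero ones, which detects vanishing at finite levels. -/
theorem Colim.exists_act_eq_zero {P : Type*} [AddCommGroup P] [Module R P] {k : ℕ}
    (q : Fin (d k) → P) (h : pair (R := R) (basisAt A k) q = 0) :
    ∃ L, ∀ l, L ≤ l → act (trans A k l) q = 0 := by
  let H : AddSubgroup (∀ l, Fin (d l) → P) :=
    { carrier := {f | ∃ L, ∀ l, L ≤ l → f l = 0}
      zero_mem' := ⟨0, fun _ _ => rfl⟩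
      add_mem' := by
        rintro f g ⟨K, hK⟩ ⟨L, hL⟩
        refine ⟨max K L, fun l hl => ?_⟩
        rw [Pi.add_apply, hK l (le_of_max_le_left hl), hL l (le_of_max_le_right hl), add_zero]
      neg_mem' := by
        rintro f ⟨L, hL⟩
        exact ⟨L, fun l hl => by rw [Pi.neg_apply, hL l hl, neg_zero]⟩ }
  let scale : ((Σ k, Fin (d k)) →₀ Rᵐᵒᵖ) →+ P →+ (∀ l, Fin (d l) → P) :=
    AddMonoidHom.mk' (fun v => AddMonoidHom.mk' (fun x l j => toLevel A l v j • x) fun a b => by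
      ext; simp) fun v w => by
      ext; simp [add_smul]
  have scale_apply (v) (x : P) : scale v x = fun l j => toLevel A l v j • x := rfl
  let β : Colim A →+ P →+ (∀ l, Fin (d l) → P) ⧸ H :=
    QuotientAddGroup.lift (Submodule.span Rᵐᵒᵖ (Set.range (levelRel A))).toAddSubgroup
      ((AddMonoidHom.compHom (QuotientAddGroup.mk' H)).comp scale) fun v hv => by
        obtain ⟨L, hL⟩ := eventually_toLevel_eq_zero A hv
        ext x
        refine (QuotientAddGroup.eq_zero_iff _).2 ⟨L, fun l hl => ?_⟩
        ext j
        simp [scale_apply, hL l hl]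
  have hβ : ∀ (x : Colim A) (s : R) (p : P), β (op s • x) p = β x (s • p) := by
    intro x s p
    obtain ⟨v, rfl⟩ := Submodule.mkQ_surjective _ x
    change QuotientAddGroup.mk' H (scale (op s • v) p) = QuotientAddGroup.mk' H (scale v (s • p))
    simp [scale_apply, mul_smul]
  have h0 := congrArg (Tensor.lift β hβ) h
  rw [map_zero, pair, map_sum] at h0
  have h1 : ∀ i, Tensor.lift β hβ (tmul R (basisAt A k i) (q i)) =
      QuotientAddGroup.mk' H (scale (Finsupp.single ⟨k, i⟩ 1) (q i)) := fun i => rfl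
  simp only [h1, ← map_sum] at h0
  obtain ⟨L, hL⟩ := (QuotientAddGroup.eq_zero_iff _).1 h0
  refine ⟨L, fun l hl => ?_⟩
  rw [← hL l hl]
  ext j
  simp [scale_apply, toLevel_single, act]

theorem Colim.exists_pair {P : Type*} [AddCommGroup P] [Module R P] (x : Tensor R (Colim A) P) :
    ∃ K, ∀ k, K ≤ k → ∃ q : Fin (d k) → P, x = pair (basisAt A k) q := by
  induction x using Tensor.induction with
  | zero => exact ⟨0, fun k _ => ⟨0, by simp⟩⟩
  | tmul m n =>
    obtain ⟨K, hK⟩ := Colim.exists_rdot A m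
    refine ⟨K, fun k hk => ?_⟩
    obtain ⟨r, rfl⟩ := hK k hk
    exact ⟨_, tmul_rdot _ r n⟩
  | add x y hx hy =>
    obtain ⟨K, hK⟩ := hx
    obtain ⟨L, hL⟩ := hy
    refine ⟨max K L, fun k hk => ?_⟩
    obtain ⟨r, rfl⟩ := hK k (le_of_max_le_left hk)
    obtain ⟨s, rfl⟩ := hL k (le_of_max_le_right hk)
    exact ⟨r + s, (pair_add _ _ _).symm⟩

theorem Colim.pair_eq_zero {P : Type*} [AddCommGroup P] [Module R P] {k l : ℕ} (h : k ≤ l)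
    {q : Fin (d k) → P} (hq : act (trans A k l) q = 0) : pair (R := R) (basisAt A k) q = 0 := by
  rw [eq_ract_trans A (basisAt_eq A) h, pair_ract, hq, pair_zero]

theorem Colim.isFlat : IsFlat (ModuleCat.of Rᵐᵒᵖ (Colim A)) := by
  intro B C f hf
  refine (injective_iff_map_eq_zero _).2 fun x hx => ?_
  obtain ⟨k, hk⟩ := Colim.exists_pair A x
  obtain ⟨q, rfl⟩ := hk k le_rfl
  rw [lTensor_pair] at hx
  obtain ⟨L, hL⟩ := Colim.exists_act_eq_zero A _ hx
  refine Colim.pair_eq_zero A (le_max_left k L) ?_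
  have h := hL (max k L) (le_max_right k L)
  rw [← map_act] at h
  ext j
  exact hf (by simpa using congrFun h j)

/-- The free module on `ι` is a retract of the one on `ℕ`, with `π ∘ s = id`. Besides the images of
the old relations, only `e_n = s (π e_n)` must be imposed. -/
theorem isCountablyPresented_of_countable {M : ModuleCat.{u} Rᵐᵒᵖ} {ι : Type*} [Countable ι]
    (f : (ι →₀ Rᵐᵒᵖ) →ₗ[Rᵐᵒᵖ] M) (hf : Function.Surjective f) {t : Set (ι →₀ Rᵐᵒᵖ)}
    (ht : t.Countable) (hker : Submodule.span Rᵐᵒᵖ t = LinearMap.ker f) :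
    IsCountablyPresented M := by
  have := Encodable.ofCountable ι
  let s : (ι →₀ Rᵐᵒᵖ) →ₗ[Rᵐᵒᵖ] (ℕ →₀ Rᵐᵒᵖ) := Finsupp.lmapDomain _ _ Encodable.encode
  let π : (ℕ →₀ Rᵐᵒᵖ) →ₗ[Rᵐᵒᵖ] (ι →₀ Rᵐᵒᵖ) :=
    Finsupp.linearCombination _ fun n => (Encodable.decode n).elim 0 fun i => Finsupp.single i 1
  have hπs : ∀ v, π (s v) = v := fun v => by
    have : π ∘ₗ s = LinearMap.id := by
      ext i : 2
      simp [π, s]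
    exact LinearMap.congr_fun this v
  refine ⟨f ∘ₗ π, fun x => ?_,
    s '' t ∪ Set.range fun n => Finsupp.single n 1 - s (π (Finsupp.single n 1)),
    (ht.image s).union (Set.countable_range _), le_antisymm ?_ fun v hv => ?_⟩
  · obtain ⟨v, rfl⟩ := hf x
    exact ⟨s v, by simp [hπs]⟩
  · rw [Submodule.span_le]
    rintro _ (⟨v, hv, rfl⟩ | ⟨n, rfl⟩)
    · have : v ∈ LinearMap.ker f := hker ▸ Submodule.subset_span hv
      simpa [hπs] using this
    · simp [hπs]
  · rw [Submodule.span_union, ← Submodule.map_span, hker]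
    rw [← add_sub_cancel (s (π v)) v]
    refine Submodule.add_mem_sup ⟨π v, by simpa using hv, rfl⟩ ?_
    clear hv
    induction v using Finsupp.induction_linear with
    | zero => simp
    | add v w hv hw =>
      rw [map_add, map_add, add_sub_add_comm]
      exact add_mem hv hw
    | single n a =>
      have : Finsupp.single n a = a • Finsupp.single n (1 : Rᵐᵒᵖ) := by simp
      rw [this, map_smul, map_smul, ← smul_sub]
      exact Submodule.smul_mem _ _ (Submodule.subset_span ⟨n, rfl⟩)

theorem Colim.isCountablyPresented : IsCountablyPresented (ModuleCat.of Rᵐᵒᵖ (Colim A)) :=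
  isCountablyPresented_of_countable (Submodule.mkQ _) (Submodule.mkQ_surjective _)
    (Set.countable_range (levelRel A)) (Submodule.ker_mkQ _).symm

end Colimit

/-! ### Transfer from countably presented modules -/

section Transfer

variable {R : Type u} [Ring R]

theorem Tensor.exists_eq_pair {M : Type*} [AddCommGroup M] [Module Rᵐᵒᵖ M] {P : Type*}
    [AddCommGroup P] [Module R P] (x : Tensor R M P) :
    ∃ (n : ℕ) (m : Fin n → M) (q : Fin n → P), x = pair m q := by
  induction x using Tensor.induction with
  | zero => exact ⟨0, 0, 0, (pair_zero _).symm⟩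
  | tmul m p => exact ⟨1, fun _ => m, fun _ => p, by simp [pair]⟩
  | add x y hx hy =>
    obtain ⟨n, m, q, rfl⟩ := hx
    obtain ⟨n', m', q', rfl⟩ := hy
    exact ⟨n + n', Fin.append m m', Fin.append q q', by simp [pair, Fin.sum_univ_add]⟩

theorem isRelMittagLeffler_of_exists_dominates {Q : Set (ModuleCat.{u} R)}
    {M : ModuleCat.{u} Rᵐᵒᵖ}
    (h : ∀ (n : ℕ) (m : Fin n → M), ∃ (k : ℕ) (y : Fin k → M) (A : Matrix (Fin k) (Fin n) R),
      m = ract y A ∧ Dominates Q m A) : IsRelMittagLeffler Q M := by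
  intro I P hP
  refine (injective_iff_map_eq_zero _).2 fun x hx => ?_
  obtain ⟨n, m, q, rfl⟩ := Tensor.exists_eq_pair x
  obtain ⟨k, y, A, hm, hA⟩ := h n m
  have h0 : act A q = 0 := by
    ext j i
    have hi := congrFun hx i
    rw [piMap_pair] at hi
    rw [act_apply_pi, hA _ (hP i) _ hi]
    rfl
  rw [hm, pair_ract, h0, pair_zero]

theorem Colim.isRelMittagLeffler {Q : Set (ModuleCat.{u} R)} {d : ℕ → ℕ}
    (A : ∀ k, Matrix (Fin (d (k + 1))) (Fin (d k)) R) {M : Type*} [AddCommGroup M] [Module Rᵐᵒᵖ M]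
    (y : ∀ k, Fin (d k) → M) (hy : ∀ k, y k = ract (y (k + 1)) (A k))
    (hA : ∀ k, Dominates Q (y k) (A k)) :
    IsRelMittagLeffler Q (ModuleCat.of Rᵐᵒᵖ (Colim A)) := by
  intro I P hP
  refine (injective_iff_map_eq_zero _).2 fun x hx => ?_
  obtain ⟨k, hk⟩ := Colim.exists_pair A x
  obtain ⟨q, rfl⟩ := hk k le_rfl
  have h0 : act (A k) q = 0 := by
    ext j i
    -- Domination is known for the rows in `M`, so each vanishing coordinate is pushed forward from
    -- the colimit to `M`.
    have hi := congrArg (rTensor (P i) (Colim.desc y hy)) (congrFun hx i)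
    rw [piMap_pair, rTensor_pair, Pi.zero_apply, map_zero] at hi
    simp only [Colim.desc_basisAt] at hi
    rw [act_apply_pi, hA k _ (hP i) _ hi]
    rfl
  rw [basisAt_eq, pair_ract, h0, pair_zero]

/-- A factorization of the row `m` through a finitely generated free module. -/
structure Factorization {M : Type*} [AddCommGroup M] [Module Rᵐᵒᵖ M] {n : ℕ} (m : Fin n → M) where
  /-- The rank of the free module. -/
  rank : ℕ
  /-- The images of the basis elements. -/
  row : Fin rank → M
  /-- The matrix expressing `m` through `row`. -/
  mat : Matrix (Fin rank) (Fin n) R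
  eq_ract : m = ract row mat

/-- One link of the chain: `B` comes from flatness and kills the column witnessing failure for `Q'`;
`C` then dominates for `Q`, and so does `C * B`. -/
theorem Factorization.exists_next {Q Q' : Set (ModuleCat.{u} R)} {M : ModuleCat.{u} Rᵐᵒᵖ}
    (hM : IsFlat M) (hQ : IsRelMittagLeffler Q M) {n : ℕ} {m : Fin n → M}
    (hm : ∀ (k : ℕ) (y : Fin k → M) (A : Matrix (Fin k) (Fin n) R), m = ract y A →
      ¬ Dominates Q' m A) (s : Factorization (R := R) m) :
    ∃ (t : Factorization (R := R) m) (A : Matrix (Fin t.rank) (Fin s.rank) R),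
      s.row = ract t.row A ∧ t.mat = A * s.mat ∧ Dominates Q s.row A ∧
      ∃ P ∈ Q', ∃ q : Fin n → P, act t.mat q = 0 ∧ act s.mat q ≠ 0 := by
  have h := hm _ _ _ s.eq_ract
  simp only [Dominates, not_forall] at h
  obtain ⟨P, hP, q, hq, hne⟩ := h
  have hq' := hq
  rw [s.eq_ract, pair_ract] at hq'
  obtain ⟨k, y, B, hy, hB⟩ := hM.exists_factor _ _ hq'
  obtain ⟨l, z, C, hz, hC⟩ := exists_dominates hM hQ y
  have hs : s.row = ract z (C * B) := by rw [ract_mul, ← hz, ← hy]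
  refine ⟨⟨l, z, C * B * s.mat, by rw [ract_mul, ← hs, ← s.eq_ract]⟩, C * B, hs, rfl,
    fun P' hP' q' h' => ?_, P, hP, q, ?_, hne⟩
  · rw [hy, pair_ract] at h'
    rw [act_mul, hC P' hP' _ h']
  · rw [act_mul, act_mul, hB, act_zero]

/-- If all countably presented flat `Q`-Mittag-Leffler modules are `Q'`-Mittag-Leffler, then all
flat `Q`-Mittag-Leffler modules are. -/
theorem isRelMittagLeffler_of_forall_isCountablyPresented {Q Q' : Set (ModuleCat.{u} R)}
    (h : ∀ N : ModuleCat.{u} Rᵐᵒᵖ, IsCountablyPresented N → IsFlat N → IsRelMittagLeffler Q N →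
      IsRelMittagLeffler Q' N)
    {M : ModuleCat.{u} Rᵐᵒᵖ} (hM : IsFlat M) (hQ : IsRelMittagLeffler Q M) :
    IsRelMittagLeffler Q' M := by
  refine isRelMittagLeffler_of_exists_dominates fun n m => ?_
  by_contra! hm
  choose next A hrow hmat hdom P hP q hq hne using
    Factorization.exists_next (Q := Q) (Q' := Q') hM hQ hm
  let s : ℕ → Factorization (R := R) m := fun k => Nat.rec ⟨n, m, 1, by simp⟩ (fun _ => next) k
  let d : ℕ → ℕ := fun k => (s k).rank
  let T : ∀ k, Matrix (Fin (d (k + 1))) (Fin (d k)) R := fun k => A (s k)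
  have hT : ∀ k, trans T 0 k = (s k).mat := fun k => by
    induction k with
    | zero => exact trans_self T 0
    | succ k ih => rw [trans_succ T (Nat.zero_le k), ih]; exact (hmat (s k)).symm
  have hN := h _ (Colim.isCountablyPresented T) (Colim.isFlat T)
    (Colim.isRelMittagLeffler T (fun k => (s k).row) (fun k => hrow (s k)) fun k => hdom (s k))
  -- The `i`-th column is dead at level `i + 1` but alive at level `i`. The Mittag-Leffler property
  -- of the colimit would kill all of them at one level `L`, against the choice of the `L`-th.
  have h0 : pair (R := R) (basisAt T 0)
      (fun j i => q (s i.down) j : Fin n → ∀ i : ULift.{u} ℕ, P (s i.down)) = 0 := by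
    refine hN (ULift.{u} ℕ) (fun i => P (s i.down)) (fun i => hP _) ?_
    ext ⟨i⟩
    refine (piMap_pair _ _ _ _).trans ?_
    rw [map_zero]
    refine Colim.pair_eq_zero T (Nat.zero_le (i + 1)) ?_
    rw [hT]
    exact hq (s i)
  obtain ⟨L, hL⟩ := Colim.exists_act_eq_zero T _ h0
  refine hne (s L) ?_
  rw [← hT]
  ext j
  have := congrFun (congrFun (hL L le_rfl) j) ⟨L⟩
  rwa [act_apply_pi] at this

theorem isRelMittagLeffler_empty (M : ModuleCat.{u} Rᵐᵒᵖ) : IsRelMittagLeffler ∅ M :=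
  isRelMittagLeffler_of_exists_dominates fun _ m => ⟨_, m, 1, by simp, fun _ h => h.elim⟩

theorem isRelMittagLeffler_univ_iff {M : ModuleCat.{u} Rᵐᵒᵖ} :
    IsRelMittagLeffler Set.univ M ↔ IsMittagLeffler M :=
  ⟨fun h I N => h I N fun _ => trivial, fun h I N _ => h I N⟩

theorem IsMittagLeffler.isRelMittagLeffler {M : ModuleCat.{u} Rᵐᵒᵖ} (h : IsMittagLeffler M)
    (Q : Set (ModuleCat.{u} R)) : IsRelMittagLeffler Q M :=
  fun I N _ => h I N

end Transfer

/-! ### Projectivity of countably presented flat Mittag-Leffler modules -/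

section Projective

variable {R : Type u} [Ring R]

/-- Dual basis: the matrix of coordinates dominates, because each coordinate functional induces a
map `M ⊗ P → P`. -/
theorem isMittagLeffler_of_projective {M : ModuleCat.{u} Rᵐᵒᵖ} [Module.Projective Rᵐᵒᵖ M] :
    IsMittagLeffler M := by
  rw [← isRelMittagLeffler_univ_iff]
  obtain ⟨s, hs⟩ := Module.projective_def'.1 ‹Module.Projective Rᵐᵒᵖ M›
  refine isRelMittagLeffler_of_exists_dominates fun n m => ?_
  classical
  let S : Finset M := Finset.univ.biUnion fun i => (s (m i)).support
  let e := S.equivFin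
  refine ⟨_, fun j => e.symm j, Matrix.of fun j i => unop (s (m i) (e.symm j)), ?_, fun P _ q hq => ?_⟩
  · ext i
    have h1 : Finsupp.linearCombination Rᵐᵒᵖ id (s (m i)) = m i := LinearMap.congr_fun hs (m i)
    rw [← h1, Finsupp.linearCombination_apply, Finsupp.sum_of_support_subset (s := S)]
    · simp only [ract, rdot, Matrix.of_apply, op_unop, id]
      rw [e.symm.sum_comp (fun b : S => s (m i) b • (b : M))]
      exact (Finset.sum_coe_sort S (fun b : M => s (m i) b • b)).symm
    · exact Finset.subset_biUnion_of_mem (fun i => (s (m i)).support) (Finset.mem_univ i)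
    · simp
  · ext j
    let c : M →ₗ[Rᵐᵒᵖ] Rᵐᵒᵖ := Finsupp.lapply (e.symm j : M) ∘ₗ s
    let β : M →+ P →+ P := (Module.toAddMonoidEnd R P).toAddMonoidHom.comp
      (opAddEquiv.symm.toAddMonoidHom.comp c.toAddMonoidHom)
    have β_apply (x : M) (p : P) : β x p = unop (c x) • p := rfl
    have := congrArg (Tensor.lift β fun x r p => by simp [β_apply, mul_smul]) hq
    simpa [pair, β_apply, c, act] using this

/-- A sequence of finite rows in `M`, each obtained from the next by a matrix that dominates it
with respect to all left modules, that generates `M`. -/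
theorem exists_dominating_sequence {M : ModuleCat.{u} Rᵐᵒᵖ} (hM : IsFlat M)
    (hML : IsMittagLeffler M) (g : ℕ → M) :
    ∃ (d : ℕ → ℕ) (A : ∀ k, Matrix (Fin (d (k + 1))) (Fin (d k)) R) (y : ∀ k, Fin (d k) → M),
      (∀ k, y k = ract (y (k + 1)) (A k)) ∧ (∀ k, Dominates Set.univ (y k) (A k)) ∧
      ∀ k, g k ∈ Set.range (y (k + 1)) := by
  have step : ∀ (k : ℕ) (s : Σ n, Fin n → M), ∃ (t : Σ n, Fin n → M)
      (A : Matrix (Fin t.1) (Fin s.1) R), s.2 = ract t.2 A ∧ Dominates Set.univ s.2 A ∧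
      g k ∈ Set.range t.2 := by
    rintro k ⟨n, m⟩
    obtain ⟨l, y, A, hm, hA⟩ := exists_dominates hM (isRelMittagLeffler_univ_iff.2 hML) m
    -- The generator enters with a zero matrix row, which affects neither the factorization nor
    -- domination.
    refine ⟨⟨l + 1, Fin.cons (g k) y⟩, Matrix.of (Fin.cons 0 A), ?_, fun P hP q hq => ?_, 0, rfl⟩
    · change m = _
      rw [hm]
      ext i
      symm
      refine (Fin.sum_univ_succ _).trans ((congrArg₂ (· + ·) ?_ rfl).trans (zero_add _))
      exact zero_smul Rᵐᵒᵖ (g k)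
    · ext j
      refine Fin.cases ?_ (fun j => ?_) j
      · exact Finset.sum_eq_zero fun i _ => zero_smul R (q i)
      · exact congrFun (hA P hP q hq) j
  choose next A h1 h2 h3 using step
  let s : ℕ → Σ n, Fin n → M := fun k => Nat.rec ⟨0, 0⟩ (fun k t => next k t) k
  exact ⟨fun k => (s k).1, fun k => A k (s k), fun k => (s k).2, fun k => h1 k (s k),
    fun k => h2 k (s k), fun k => h3 k (s k)⟩

/-- Test domination on `R^n` modulo the row space of `B`: the column of basis classes is killed by
`B`, hence by `m`, hence by `A`, so the rows of `A` lie in that row space. -/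
theorem Dominates.exists_eq_mul {M : Type*} [AddCommGroup M] [Module Rᵐᵒᵖ M] {n k l : ℕ}
    {m : Fin n → M} {A : Matrix (Fin k) (Fin n) R} (hA : Dominates Set.univ m A)
    {z : Fin l → M} {B : Matrix (Fin l) (Fin n) R} (hm : m = ract z B) :
    ∃ C : Matrix (Fin k) (Fin l) R, A = C * B := by
  let K : Submodule R (Fin n → R) := Submodule.span R (Set.range B.row)
  have key {j : ℕ} (D : Matrix (Fin j) (Fin n) R) :
      act D (fun i => K.mkQ (Pi.single i 1)) = fun i => K.mkQ (D.row i) := by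
    ext i
    simp only [act, ← map_smul, ← map_sum]
    congr 1
    ext t
    simp [Finset.sum_apply, Pi.single_apply]
  have h := hA (ModuleCat.of R ((Fin n → R) ⧸ K)) trivial (fun i => K.mkQ (Pi.single i 1)) <| by
    rw [hm, pair_ract, key]
    convert pair_zero z with i
    rw [Submodule.mkQ_apply, Pi.zero_apply, Submodule.Quotient.mk_eq_zero]
    exact Submodule.subset_span ⟨i, rfl⟩
  have hmem : ∀ j, ∃ c : Fin l → R, ∑ i, c i • B.row i = A.row j := fun j => by
    rw [← Submodule.mem_span_range_iff_exists_fun]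
    have := congrFun ((key A).symm.trans h) j
    rwa [Pi.zero_apply, Submodule.mkQ_apply, Submodule.Quotient.mk_eq_zero] at this
  choose C hC using hmem
  refine ⟨C, ?_⟩
  ext j i
  refine (congrFun (hC j) i).symm.trans (Eq.trans ?_ (Matrix.mul_apply (M := C)).symm)
  simp

/-- The hypothesis is a Mittag-Leffler condition on the dual inverse system; it allows lifts chosen
level by level to be corrected into a compatible sequence. -/
theorem Colim.projective {d : ℕ → ℕ} (A : ∀ k, Matrix (Fin (d (k + 1))) (Fin (d k)) R)
    (C : ∀ k, Matrix (Fin (d (k + 1))) (Fin (d (k + 2))) R)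
    (hC : ∀ k, A k = C k * (A (k + 1) * A k)) : Module.Projective Rᵐᵒᵖ (Colim A) := by
  refine Module.Projective.of_lifting_property'' fun p hp => ?_
  choose σ hσ using hp
  -- `t k` lifts the basis of level `k + 1`. The correction by `C k` lies in the kernel of `p` and
  -- gives `t (k + 1) * A (k + 1) * A k = t k * A k`; hence the rows `t k * A k`, not `t k`, are
  -- compatible.
  let t : ∀ k, Fin (d (k + 1)) → (Colim A →₀ Rᵐᵒᵖ) := fun k =>
    Nat.rec (fun i => σ (basisAt A 1 i)) (fun k t =>
      let w := fun i => σ (basisAt A (k + 2) i)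
      w + ract (t - ract w (A (k + 1))) (C k)) k
  have ht_succ : ∀ k, t (k + 1) = (fun i => σ (basisAt A (k + 2) i)) +
      ract (t k - ract (fun i => σ (basisAt A (k + 2) i)) (A (k + 1))) (C k) := fun k => rfl
  have hpt : ∀ k, (fun i => p (t k i)) = basisAt A (k + 1) := by
    intro k
    induction k with
    | zero => ext1 i; exact hσ _
    | succ k ih =>
      ext1 i
      have h1 : (fun i => p ((t k - ract (fun i => σ (basisAt A (k + 2) i)) (A (k + 1))) i)) = 0 := by
        have h2 := map_ract p (fun i => σ (basisAt A (k + 2) i)) (A (k + 1))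
        simp only [hσ] at h2
        rw [← basisAt_eq] at h2
        ext1 i
        rw [Pi.sub_apply, map_sub, congrFun ih i, congrFun h2 i, sub_self, Pi.zero_apply]
      have h3 := congrFun (map_ract p
        (t k - ract (fun i => σ (basisAt A (k + 2) i)) (A (k + 1))) (C k)) i
      rw [h1] at h3
      rw [ht_succ, Pi.add_apply, map_add, hσ, h3]
      simp [ract, rdot]
  let y : ∀ k, Fin (d k) → (Colim A →₀ Rᵐᵒᵖ) := fun k => ract (t k) (A k)
  have hy : ∀ k, y k = ract (y (k + 1)) (A k) := by
    intro k
    simp only [y, ← ract_mul]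
    rw [ht_succ, add_ract, ← ract_mul, ← hC, ract_mul _ (A (k + 1)), ← add_ract,
      add_sub_cancel]
  refine ⟨Colim.desc y hy, ?_⟩
  have hb : ∀ k i, p (Colim.desc y hy (basisAt A k i)) = basisAt A k i := fun k i => by
    rw [Colim.desc_basisAt, congrFun (map_ract p (t k) (A k)) i, hpt, ← basisAt_eq]
  refine LinearMap.ext fun x => ?_
  obtain ⟨k, hk⟩ := Colim.exists_rdot A x
  obtain ⟨r, rfl⟩ := hk k le_rfl
  have := map_rdot (p ∘ₗ Colim.desc y hy) (basisAt A k) r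
  rw [this]
  simp only [LinearMap.comp_apply, hb, LinearMap.id_apply]

theorem projective_of_isCountablyPresented {M : ModuleCat.{u} Rᵐᵒᵖ} (hc : IsCountablyPresented M)
    (hM : IsFlat M) (hML : IsMittagLeffler M) : Module.Projective Rᵐᵒᵖ M := by
  obtain ⟨f, hf, -⟩ := hc
  obtain ⟨d, A, y, hy, hA, hg⟩ :=
    exists_dominating_sequence hM hML fun n => f (Finsupp.single n 1)
  have hC : ∀ k, ∃ C, A k = C * (A (k + 1) * A k) := fun k =>
    (hA k).exists_eq_mul (z := y (k + 2)) (by rw [ract_mul, ← hy, ← hy])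
  choose C hC using hC
  have := Colim.projective A C hC
  have hinj : Function.Injective (Colim.desc y hy) := by
    refine (injective_iff_map_eq_zero _).2 fun x hx => ?_
    obtain ⟨k, hk⟩ := Colim.exists_rdot A x
    obtain ⟨r, rfl⟩ := hk k le_rfl
    rw [map_rdot] at hx
    simp only [Colim.desc_basisAt] at hx
    -- Domination for the left module `R`: a combination vanishing in `M` already has zero
    -- coefficients one level up.
    have h0 := hA k (ModuleCat.of R R) trivial r <| by
      rw [pair_eq_tmul_rdot, hx]
      exact map_zero ((tmulHom R M R).flip 1)
    rw [basisAt_eq, rdot_ract, h0, rdot_zero]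
  have hsurj : Function.Surjective (Colim.desc y hy) := by
    intro x
    obtain ⟨v, rfl⟩ := hf x
    change f v ∈ LinearMap.range (Colim.desc y hy)
    induction v using Finsupp.induction_linear with
    | zero => simp
    | add v w hv hw => rw [map_add]; exact add_mem hv hw
    | single n a =>
      obtain ⟨i, hi⟩ := hg n
      have ha : Finsupp.single n a = a • Finsupp.single n (1 : Rᵐᵒᵖ) := by simp
      rw [ha, map_smul]
      refine Submodule.smul_mem _ _ ⟨basisAt A (n + 1) i, ?_⟩
      rw [Colim.desc_basisAt, hi]
  exact Module.Projective.of_equiv (LinearEquiv.ofBijective _ ⟨hinj, hsurj⟩)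

end Projective

end RelML

theorem theorem2p5 (R : Type u) [Ring R] :
    (∀ Q Q' : Set (ModuleCat.{u} R), ModuleCat.of R R ∈ Q → ModuleCat.of R R ∈ Q' →
      (RelML.flatRelMLClass Q = RelML.flatRelMLClass Q' ↔
        ∀ M : ModuleCat.{u} Rᵐᵒᵖ, RelML.IsCountablyPresented M →
          (M ∈ RelML.flatRelMLClass Q ↔ M ∈ RelML.flatRelMLClass Q'))) ∧
    (∀ Q : Set (ModuleCat.{u} R),
      (RelML.flatRelMLClass Q = RelML.flatClass R ↔
        ∀ M : ModuleCat.{u} Rᵐᵒᵖ, RelML.IsCountablyPresented M → RelML.IsFlat M →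
          RelML.IsRelMittagLeffler Q M)) ∧
    (∀ Q : Set (ModuleCat.{u} R), ModuleCat.of R R ∈ Q →
      (RelML.flatRelMLClass Q = RelML.flatMLClass R ↔
        ∀ M : ModuleCat.{u} Rᵐᵒᵖ, RelML.IsCountablyPresented M → RelML.IsFlat M →
          RelML.IsRelMittagLeffler Q M → Module.Projective Rᵐᵒᵖ M)) := by
  refine ⟨fun Q Q' _ _ => ⟨fun h M _ => by rw [h], fun h => ?_⟩,
    fun Q => ⟨fun h M _ hM => (h.ge hM).2, fun h => ?_⟩,
    fun Q _ => ⟨fun h M hc hM hQ => ?_, fun h => ?_⟩⟩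
  · refine Set.Subset.antisymm (fun M hM => ⟨hM.1, ?_⟩) fun M hM => ⟨hM.1, ?_⟩
    · exact RelML.isRelMittagLeffler_of_forall_isCountablyPresented
        (fun N hc hN hQ => ((h N hc).1 ⟨hN, hQ⟩).2) hM.1 hM.2
    · exact RelML.isRelMittagLeffler_of_forall_isCountablyPresented
        (fun N hc hN hQ => ((h N hc).2 ⟨hN, hQ⟩).2) hM.1 hM.2
  · refine Set.Subset.antisymm (fun M hM => hM.1) fun M hM => ⟨hM, ?_⟩
    -- The source class is empty, so its Mittag-Leffler condition is void.
    exact RelML.isRelMittagLeffler_of_forall_isCountablyPresented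
      (fun N hc hN _ => h N hc hN) hM (RelML.isRelMittagLeffler_empty M)
  · exact RelML.projective_of_isCountablyPresented hc hM (h.le ⟨hM, hQ⟩).2
  · refine Set.Subset.antisymm (fun M hM => ⟨hM.1, ?_⟩) fun M hM =>
      ⟨hM.1, hM.2.isRelMittagLeffler Q⟩
    refine RelML.isRelMittagLeffler_univ_iff.1
      (RelML.isRelMittagLeffler_of_forall_isCountablyPresented (fun N hc hN hQ => ?_) hM.1 hM.2)
    have := h N hc hN hQ
    exact RelML.isRelMittagLeffler_univ_iff.2 RelML.isMittagLeffler_of_projective
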